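/- Let $G$ be a finite simple graph on the vertex set $[m]$, and consider the broadcast network in which, for every $i\in[m]$, there is exactly one receiver that is interested in the block $x_i$ and knows exactly the blocks $x_j$ with $j\in N_G(i)$. The confusion graph $\mathfrak{C}(G)$ (for block length $1$) is the graph on the vertex set $\{0,1\}^m$ in which two words $x\neq y$ are adjacent if and only if there is some $i\in[m]$ such that $x_i\neq y_i$ and $x_j=y_j$ for all $j\in N_G(i)$. Let $\chi$ denote the chromatic number and $\chi_f$ the fractional chromatic number, i.e. the minimum total weight of an assignment of weights in $[0,1]$ to the independent sets of the graph such that, for every vertex, the total weight of the independent sets containing it is at least $1$. Let $\overline{C}_k$ denote the complement of the cycle on $k$ vertices. Then there exists a constant $c>1$ such that for every integer $n\ge 2$, $$\chi\bigl(\mathfrak{C}(\overline{C}_{2n+1})\bigr) > c\cdot \chi_f\bigl(\mathfrak{C}(\overline{C}_{2n+1})\bigr).$$ -/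

import Mathlib

/-- A directed hypergraph on the vertex set `V`: every edge `(i, J)` is a receiver that is
interested in the block `x i` and knows the blocks `x j` for `j ∈ J`. -/
structure DirectedHypergraph (V : Type*) where
  edges : Set (V × Set V)

/-- The directed hypergraph of an undirected graph `G`: for each vertex `i` there is precisely one
directed edge with origin `i`, namely `(i, N_G(i))`. -/
def DirectedHypergraph.ofGraph {V : Type*} (G : SimpleGraph V) : DirectedHypergraph V where
  edges := {e | e.2 = G.neighborSet e.1}

/-- The confusion graph of a directed hypergraph (for block length `1`): the vertices are the binary
words indexed by `V`, and two distinct words are adjacent iff some receiver confuses them. -/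
def DirectedHypergraph.confusionGraph {V : Type*} (H : DirectedHypergraph V) :
    SimpleGraph (V → Bool) where
  Adj x y := x ≠ y ∧ ∃ e ∈ H.edges, x e.1 ≠ y e.1 ∧ ∀ j ∈ e.2, x j = y j
  symm := ⟨by
    rintro x y ⟨hxy, e, he, hne, hJ⟩
    exact ⟨hxy.symm, e, he, hne.symm, fun j hj => (hJ j hj).symm⟩⟩
  loopless := ⟨fun _ h => h.1 rfl⟩

open Classical in
/-- A fractional coloring of a finite graph: weights in `[0, 1]` on the independent sets (extended by
`0` to all sets of vertices) such that every vertex is covered by a total weight of at least `1`. -/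
structure SimpleGraph.IsFractionalColoring {V : Type*} [Fintype V] (G : SimpleGraph V)
    (w : Finset V → ℝ) : Prop where
  nonneg : ∀ I, 0 ≤ w I
  le_one : ∀ I, w I ≤ 1
  eq_zero : ∀ I : Finset V, ¬ G.IsIndepSet (I : Set V) → w I = 0
  one_le_cover : ∀ v : V, 1 ≤ ∑ I : Finset V with v ∈ I, w I

/-- The fractional chromatic number of a finite graph: the minimum total weight of a fractional
coloring. -/
noncomputable def SimpleGraph.fractionalChromaticNumber {V : Type*} [Fintype V]
    (G : SimpleGraph V) : ℝ :=
  sInf {s : ℝ | ∃ w : Finset V → ℝ, G.IsFractionalColoring w ∧ s = ∑ I : Finset V, w I}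

/-- The confusion graph of the complement of the cycle on `m` vertices. -/
def confusionAntihole (m : ℕ) : SimpleGraph (Fin m → Bool) :=
  (DirectedHypergraph.ofGraph (SimpleGraph.cycleGraph m)ᶜ).confusionGraph

/-! Put `m = 2n+1`. Two words are confused iff, for some `i`, they differ at `i` and agree outside
`i` and its two neighbours on the cycle. The constant is `1.004`; upper bounds on the fractional
chromatic number are compared with integer lower bounds on the chromatic number.

Upper bound: translates of an independent set `S` of words form a fractional colouring of weight
`2^m / |S|`. The set `S` consists of the sums of edges of the cycle over all edge sets of size at
most `n-1` and of the parity of `n-1` (`isIndepSet_edgeSum`). The bounds are `32/5` for `n = 2`,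
`128/22 < 6` for `n = 3` and `2^17/26333 < 5` for `n = 8`. Folding a longer odd cycle onto a shorter
one induces a homomorphism of confusion graphs (`confusionHom`, `cycleFold`), so each bound persists
for all larger `n`.

Lower bound: renumber the cycle so that the neighbours of `k` are `k ± n`. In a coset of the group
generated by the letters `k`, `k+1`, `k+n+1`, the eight words split into four pairs with disjoint
colour sets, so the number of colours is at least four plus the number of bichromatic pairs
(`sum_cube_le`). Averaging over all words and all `k`, at least `r` colour changes around every word
force `4 + 4r/m` colours. Since `n` consecutive steps around a word always contain a change, `r = 1`
always holds and `r = 3` holds for `m = 5`, which gives at least 5 and at least 7 colours.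

For `3 ≤ n ≤ 7` six colours are needed, and by folding it suffices to exclude five at `m = 15`.
There `r = 4` is enough, as `76 > 75`. A word with at most three changes would be surrounded by
three monochromatic arcs; each of the seven possible arc patterns is refuted by a verified search.
-/

/-! ### A propagation search for `5`-colourings, evaluated in the kernel

A colouring of the natural numbers is constrained by `f x ≠ f (x ^^^ d)` for `d` in a list of shifts.
The state of the search holds, for each of the five colours, a bit mask of the numbers that cannot
have this colour, and a mask of the numbers whose colour has been propagated. -/

/-- `force n k = k n`, but kernel reduction evaluates `n` to a literal first. -/
noncomputable def force {α : Type} (n : ℕ) (k : ℕ → α) : α :=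
  Nat.rec (k 0) (fun m _ => k m) (Nat.add n 1)

/-- The mask of the numbers `v ^^^ d`, for `d` in the list. -/
noncomputable def shiftMask (v : ℕ) (D : List ℕ) : ℕ :=
  List.rec 0 (fun d _ r => Nat.lor (Nat.shiftLeft 1 (Nat.xor v d)) r) D

/-- Adds to the mask `acc` the shifts of `base + v`, for the members `v < 2 ^ k` of the mask `U`. -/
noncomputable def spread (D : List ℕ) (k : ℕ) : ℕ → ℕ → ℕ → ℕ :=
  Nat.rec (fun U base acc =>
      bif Nat.beq (Nat.land U 1) 0 then acc else Nat.lor acc (shiftMask base D))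
    (fun k ih U base acc =>
      bif Nat.beq U 0 then acc else
      force (Nat.pow 2 k) fun h =>
      force (Nat.pow 2 h) fun p =>
      force (Nat.shiftRight U h) fun hi =>
      force (Nat.mod U p) fun lo =>
      force (Nat.add base h) fun base' =>
      force (ih hi base' acc) fun acc' => ih lo base acc') k

/-- The state of the search. -/
structure MaskState where
  (a b c d e : ℕ)
  done : ℕ

/-- The elements of the mask `x` outside `z`. -/
noncomputable def maskDiff (x z : ℕ) : ℕ := Nat.xor x (Nat.land x z)

/-- Propagation of the numbers with a single possible colour; `none` if some number has none. -/
noncomputable def propagate (D : List ℕ) (fuel : ℕ) : MaskState → Option MaskState :=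
  Nat.rec (fun s => some s)
    (fun _ ih s => MaskState.rec (fun a b c d e z =>
      force (Nat.land a b) fun ab =>
      force (Nat.land d e) fun de =>
      force (Nat.land ab c) fun abc =>
      bif Nat.beq (Nat.land abc de) 0 then
        force (maskDiff (Nat.land b (Nat.land c de)) z) fun u0 =>
        force (maskDiff (Nat.land a (Nat.land c de)) z) fun u1 =>
        force (maskDiff (Nat.land ab de) z) fun u2 =>
        force (maskDiff (Nat.land abc e) z) fun u3 =>
        force (maskDiff (Nat.land abc d) z) fun u4 =>
        force (Nat.lor u0 (Nat.lor u1 (Nat.lor u2 (Nat.lor u3 u4)))) fun u =>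
        bif Nat.beq u 0 then some s else
        -- The depth `15` covers masks with one bit for each of the `2 ^ 15` words of length `15`.
        force (spread D 15 u0 0 a) fun a' =>
        force (spread D 15 u1 0 b) fun b' =>
        force (spread D 15 u2 0 c) fun c' =>
        force (spread D 15 u3 0 d) fun d' =>
        force (spread D 15 u4 0 e) fun e' =>
        force (Nat.lor z u) fun z' => ih ⟨a', b', c', d', e', z'⟩
      else none) s) fuel

/-- The state in which `v` is known to have the colour `k`. -/
noncomputable def restrictColour (v : ℕ) (k : Fin 5) (s : MaskState) : MaskState :=
  MaskState.rec (fun a b c d e z =>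
    force (Nat.pow 2 v) fun x =>
    force (bif Nat.beq k.1 0 then a else Nat.lor a x) fun a' =>
    force (bif Nat.beq k.1 1 then b else Nat.lor b x) fun b' =>
    force (bif Nat.beq k.1 2 then c else Nat.lor c x) fun c' =>
    force (bif Nat.beq k.1 3 then d else Nat.lor d x) fun d' =>
    force (bif Nat.beq k.1 4 then e else Nat.lor e x) fun e' => ⟨a', b', c', d', e', z⟩) s

/-- Depth-first search that branches on the numbers of the list, in preorder. If every branch ends in
a conflict, the result is the unused part of the list. -/
noncomputable def refute (D : List ℕ) (fuel : ℕ) : List ℕ → MaskState → Option (List ℕ) :=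
  Nat.rec (fun _ _ => none)
    (fun _ ih l s => List.rec none (fun v l _ =>
      let step (k : Fin 5) (l : List ℕ) : Option (List ℕ) :=
        Option.rec (some l) (fun t => ih l t) (propagate D 1000 (restrictColour v k s))
      Option.rec none (fun l => Option.rec none (fun l => Option.rec none (fun l =>
        Option.rec none (fun l => step 4 l) (step 3 l)) (step 2 l)) (step 1 l)) (step 0 l)) l) fuel

/-- The search succeeds from the given initial colours. -/
noncomputable def refutes (D : List ℕ) (init : List (ℕ × Fin 5)) (l : List ℕ) : Bool :=
  Option.rec true (fun t => (refute D 100 l t).isSome)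
    (propagate D 1000 (init.foldr (fun p s => restrictColour p.1 p.2 s) ⟨0, 0, 0, 0, 0, 0⟩))

/-- The differences of the words, for `n = 7`, that `IsConfusionColouring` separates: position `i` has
the neighbours `i + 7` and `i + 8` modulo `15`, and words are coded in binary. -/
def antiholeShifts : List ℕ :=
  [1, 129, 385, 2, 258, 770, 4, 516, 1540, 8, 1032, 3080, 16, 2064, 6160, 32, 4128, 12320, 64, 8256,
    24640, 128, 16512, 16513, 256, 257, 259, 512, 514, 518, 1024, 1028, 1036, 2048, 2056, 2072, 4096,
    4112, 4144, 8192, 8224, 8288, 16384, 16448, 16576]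

/-- The colour `4` for the zero word, and the colours `0`, `1`, `2` for the words with a single
nonzero letter, which change at the positions `p` and `q`. -/
noncomputable def arcColours (p q : ℕ) : List (ℕ × Fin 5) :=
  (0, 4) :: (List.range 15).map fun i => (2 ^ i, if i < p then 0 else if i < q then 1 else 2)

/-! ### Search certificates for the seven arc patterns. -/

-- The list holds the branching words in preorder. It is only a certificate: soundness of the search
-- does not depend on it.
set_option maxHeartbeats 4000000 in
theorem refutes_arcs_5_10 :
    refutes antiholeShifts (arcColours 5 10)
      [8193, 80, 1280, 40, 2560, 16386, 520, 4608, 1060, 544, 4616, 8226, 4608, 2060, 36,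
        20, 34, 8194, 8194, 288] = true := by
  decide +kernel

set_option maxHeartbeats 4000000 in
theorem refutes_arcs_6_11 :
    refutes antiholeShifts (arcColours 6 11)
      [80, 5120, 2560, 160, 8193, 288, 33, 16386, 8194, 4098, 4608, 162, 5124, 18] = true := by
  decide +kernel

set_option maxHeartbeats 4000000 in
theorem refutes_arcs_6_12 :
    refutes antiholeShifts (arcColours 6 12)
      [5120, 16386, 80, 160, 33, 2112, 144, 8193, 288, 8194, 10240, 72, 9216, 8706, 1088,
        34] = true := by
  decide +kernel

set_option maxHeartbeats 4000000 in
theorem refutes_arcs_7_11 :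
    refutes antiholeShifts (arcColours 7 11)
      [2560, 5120, 160, 16386, 33, 66, 258, 16417, 8194, 34, 4608, 18, 162, 34, 4097, 4608,
        18, 322] = true := by
  decide +kernel

set_option maxHeartbeats 4000000 in
theorem refutes_arcs_7_12 :
    refutes antiholeShifts (arcColours 7 12)
      [257, 8256, 8224, 16386, 258, 5120, 66, 8194, 10240, 288, 160, 8448, 4610, 8704, 36,
        9216, 514, 16898, 642, 133] = true := by
  decide +kernel

set_option maxHeartbeats 4000000 in
theorem refutes_arcs_7_13 :
    refutes antiholeShifts (arcColours 7 13)
      [258, 20480, 10240, 4224, 160, 144, 4097, 33, 16386, 3, 257, 288, 66, 576, 8194, 17,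
        384, 18432, 2049, 8256, 224, 16387, 514, 4352, 16388, 2057, 17416, 136, 68, 516,
        16388, 2057, 18440, 136, 68, 4112, 48, 2064, 34, 4352, 16387, 514, 16388, 17416, 68,
        516, 16388, 17416, 68] = true := by
  decide +kernel

set_option maxHeartbeats 4000000 in
theorem refutes_arcs_7_14 :
    refutes antiholeShifts (arcColours 7 14)
      [258, 4128, 16386, 20480, 33, 288, 4097, 66, 8194, 8704, 4224, 17, 3, 576, 12288, 144,
        8224, 257, 96, 384, 8448, 16387, 16388, 8196, 768, 68, 514, 4352, 28672, 18432,
        17412, 2064, 2064, 18432, 17412, 516, 16388, 8196, 68, 34, 514, 28672, 18432, 17412,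
        2064, 2064, 18432, 17412] = true := by
  decide +kernel

/-! ### Soundness of the search. -/

namespace MaskState

/-- The masks of the state exclude only colours that `f` does not use. -/
def Sound (f : ℕ → Fin 5) (s : MaskState) : Prop :=
  ∀ v, (s.a.testBit v → f v ≠ 0) ∧ (s.b.testBit v → f v ≠ 1) ∧ (s.c.testBit v → f v ≠ 2) ∧
    (s.d.testBit v → f v ≠ 3) ∧ (s.e.testBit v → f v ≠ 4)

end MaskState

theorem testBit_shiftMask {v w : ℕ} {D : List ℕ} (h : (shiftMask v D).testBit w) :
    ∃ d ∈ D, w = v ^^^ d := by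
  induction D with
  | nil => simp [shiftMask] at h
  | cons d D ih =>
    have h' : (2 ^ (v ^^^ d) ||| shiftMask v D).testBit w := by
      simpa [shiftMask, Nat.one_shiftLeft] using h
    rw [Nat.testBit_or, Bool.or_eq_true] at h'
    rcases h' with h' | h'
    · rw [Nat.testBit_two_pow] at h'
      exact ⟨d, by simp, (of_decide_eq_true h').symm⟩
    · obtain ⟨e, he, rfl⟩ := ih h'
      exact ⟨e, by simp [he], rfl⟩

theorem cond_beq_zero {α : Type} (n : ℕ) (x y : α) :
    (bif Nat.beq n 0 then x else y) = if n = 0 then x else y := by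
  cases n <;> rfl

theorem spread_zero (D : List ℕ) (U base acc : ℕ) :
    spread D 0 U base acc = if U &&& 1 = 0 then acc else acc ||| shiftMask base D :=
  cond_beq_zero _ _ _

theorem spread_succ (D : List ℕ) (k U base acc : ℕ) :
    spread D (k + 1) U base acc = if U = 0 then acc else
      spread D k (U % 2 ^ 2 ^ k) base (spread D k (U >>> 2 ^ k) (base + 2 ^ k) acc) :=
  cond_beq_zero _ _ _

theorem testBit_spread {D : List ℕ} {k U base acc w : ℕ}
    (h : (spread D k U base acc).testBit w) :
    acc.testBit w ∨ ∃ v, U.testBit v ∧ ∃ d ∈ D, w = (base + v) ^^^ d := by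
  induction k generalizing U base acc with
  | zero =>
    rw [spread_zero] at h
    split_ifs at h with hU
    · exact Or.inl h
    · rw [Nat.testBit_or, Bool.or_eq_true] at h
      refine h.imp id fun h => ⟨0, ?_, by simpa using testBit_shiftMask h⟩
      rw [Nat.and_one_is_mod] at hU
      rw [Nat.testBit_zero]
      simp; omega
  | succ k ih =>
    rw [spread_succ] at h
    split_ifs at h with hU
    · exact Or.inl h
    · rcases ih h with h | ⟨v, hv, d, hd, rfl⟩
      · rcases ih h with h | ⟨v, hv, d, hd, rfl⟩
        · exact Or.inl h
        · rw [Nat.testBit_shiftRight] at hv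
          exact Or.inr ⟨2 ^ k + v, hv, d, hd, by rw [add_assoc]⟩
      · rw [Nat.testBit_mod_two_pow, Bool.and_eq_true] at hv
        exact Or.inr ⟨v, hv.2, d, hd, rfl⟩

theorem testBit_maskDiff {x z v : ℕ} (h : (maskDiff x z).testBit v) : x.testBit v := by
  have h' : (x ^^^ (x &&& z)).testBit v := h
  simp only [Nat.testBit_xor, Nat.testBit_and] at h'
  revert h'
  cases x.testBit v <;> simp

theorem ne_of_testBit_spread {D : List ℕ} {f : ℕ → Fin 5}
    (hf : ∀ v, ∀ d ∈ D, f v ≠ f (v ^^^ d)) {c : Fin 5} {U acc k : ℕ}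
    (hU : ∀ v, U.testBit v → f v = c) (hacc : ∀ v, acc.testBit v → f v ≠ c) (w : ℕ)
    (h : (spread D k U 0 acc).testBit w) : f w ≠ c := by
  rcases testBit_spread h with h | ⟨v, hv, d, hd, rfl⟩
  · exact hacc w h
  · rw [zero_add, ← hU v hv]
    exact (hf v d hd).symm

/-- One round of propagation. -/
theorem propagate_succ (D : List ℕ) (n a b c d e z : ℕ) :
    propagate D (n + 1) ⟨a, b, c, d, e, z⟩ =
      if a &&& b &&& c &&& (d &&& e) = 0 then
        let u0 := maskDiff (b &&& (c &&& (d &&& e))) z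
        let u1 := maskDiff (a &&& (c &&& (d &&& e))) z
        let u2 := maskDiff (a &&& b &&& (d &&& e)) z
        let u3 := maskDiff (a &&& b &&& c &&& e) z
        let u4 := maskDiff (a &&& b &&& c &&& d) z
        let u := u0 ||| (u1 ||| (u2 ||| (u3 ||| u4)))
        if u = 0 then some ⟨a, b, c, d, e, z⟩ else
          propagate D n ⟨spread D 15 u0 0 a, spread D 15 u1 0 b, spread D 15 u2 0 c,
            spread D 15 u3 0 d, spread D 15 u4 0 e, z ||| u⟩
      else none := by
  rw [← cond_beq_zero]
  simp only [← cond_beq_zero]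
  rfl

/-- A number excluded from four colours must have the fifth, which is then excluded at all its
shifts. Running out of fuel is harmless, since every intermediate state is sound. -/
theorem MaskState.Sound.propagate {D : List ℕ} {f : ℕ → Fin 5}
    (hf : ∀ v, ∀ d ∈ D, f v ≠ f (v ^^^ d)) {n : ℕ} {s : MaskState} (hs : s.Sound f) :
    ∃ t, propagate D n s = some t ∧ t.Sound f := by
  induction n generalizing s with
  | zero => exact ⟨s, rfl, hs⟩
  | succ n ih =>
    obtain ⟨a, b, c, d, e, z⟩ := s
    rw [propagate_succ]
    have hcol : ∀ v, f v = 0 ∨ f v = 1 ∨ f v = 2 ∨ f v = 3 ∨ f v = 4 := by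
      intro v; generalize f v = x; revert x; decide
    rw [if_pos]
    · extract_lets u0 u1 u2 u3 u4 u
      split_ifs with hu
      · exact ⟨_, rfl, hs⟩
      · apply ih
        have k0 : ∀ v, u0.testBit v → f v = 0 := fun v hv => by
          have := testBit_maskDiff hv
          simp only [Nat.testBit_and, Bool.and_eq_true] at this
          have h1 := hs v; have h2 := hcol v; simp only at h1; tauto
        have k1 : ∀ v, u1.testBit v → f v = 1 := fun v hv => by
          have := testBit_maskDiff hv
          simp only [Nat.testBit_and, Bool.and_eq_true] at this
          have h1 := hs v; have h2 := hcol v; simp only at h1; tauto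
        have k2 : ∀ v, u2.testBit v → f v = 2 := fun v hv => by
          have := testBit_maskDiff hv
          simp only [Nat.testBit_and, Bool.and_eq_true] at this
          have h1 := hs v; have h2 := hcol v; simp only at h1; tauto
        have k3 : ∀ v, u3.testBit v → f v = 3 := fun v hv => by
          have := testBit_maskDiff hv
          simp only [Nat.testBit_and, Bool.and_eq_true] at this
          have h1 := hs v; have h2 := hcol v; simp only at h1; tauto
        have k4 : ∀ v, u4.testBit v → f v = 4 := fun v hv => by
          have := testBit_maskDiff hv
          simp only [Nat.testBit_and, Bool.and_eq_true] at this
          have h1 := hs v; have h2 := hcol v; simp only at h1; tauto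
        intro v
        have spread_sound : ∀ {c : Fin 5} {U acc : ℕ}, (∀ v, U.testBit v → f v = c) →
            (∀ v, acc.testBit v → f v ≠ c) → (spread D 15 U 0 acc).testBit v → f v ≠ c :=
          fun hU hacc => ne_of_testBit_spread hf hU hacc v
        exact ⟨spread_sound k0 fun w => (hs w).1, spread_sound k1 fun w => (hs w).2.1,
          spread_sound k2 fun w => (hs w).2.2.1, spread_sound k3 fun w => (hs w).2.2.2.1,
          spread_sound k4 fun w => (hs w).2.2.2.2⟩
    -- A number in all five masks would have no colour under `f`.
    · apply Nat.eq_of_testBit_eq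
      intro v
      rw [Nat.zero_testBit, ← Bool.not_eq_true]
      intro hv
      simp only [Nat.testBit_and, Bool.and_eq_true] at hv
      have h1 := hs v; have h2 := hcol v; simp only at h1; tauto

theorem restrictColour_eq (v : ℕ) (k : Fin 5) (s : MaskState) :
    restrictColour v k s =
      ⟨if k = 0 then s.a else s.a ||| 2 ^ v, if k = 1 then s.b else s.b ||| 2 ^ v,
        if k = 2 then s.c else s.c ||| 2 ^ v, if k = 3 then s.d else s.d ||| 2 ^ v,
        if k = 4 then s.e else s.e ||| 2 ^ v, s.done⟩ := by
  obtain ⟨a, b, c, d, e, z⟩ := s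
  fin_cases k <;> rfl

theorem MaskState.Sound.restrictColour {f : ℕ → Fin 5} {s : MaskState} (hs : s.Sound f) {v : ℕ}
    {k : Fin 5} (hk : f v = k) : (restrictColour v k s).Sound f := by
  have key : ∀ (x : ℕ) (j : Fin 5), (∀ w, x.testBit w → f w ≠ j) →
      ∀ w, (if k = j then x else x ||| 2 ^ v).testBit w → f w ≠ j := by
    intro x j hx w hw
    split_ifs at hw with h
    · exact hx w hw
    · rw [Nat.testBit_or, Bool.or_eq_true] at hw
      rcases hw with hw | hw
      · exact hx w hw
      · rw [Nat.testBit_two_pow] at hw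
        rw [← of_decide_eq_true hw, hk]
        exact h
  rw [restrictColour_eq]
  exact fun w => ⟨key _ _ (fun w => (hs w).1) w, key _ _ (fun w => (hs w).2.1) w,
    key _ _ (fun w => (hs w).2.2.1) w, key _ _ (fun w => (hs w).2.2.2.1) w,
    key _ _ (fun w => (hs w).2.2.2.2) w⟩

/-- The result of the search when the colour of `v` is `k`. -/
noncomputable def refuteStep (D : List ℕ) (n v : ℕ) (s : MaskState) (k : Fin 5) (l : List ℕ) :
    Option (List ℕ) :=
  match propagate D 1000 (restrictColour v k s) with
  | none => some l
  | some t => refute D n l t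

theorem refute_cons (D : List ℕ) (n v : ℕ) (l : List ℕ) (s : MaskState) :
    refute D (n + 1) (v :: l) s =
      (refuteStep D n v s 0 l).bind fun l => (refuteStep D n v s 1 l).bind fun l =>
        (refuteStep D n v s 2 l).bind fun l => (refuteStep D n v s 3 l).bind
          (refuteStep D n v s 4) := by
  have step : ∀ (k : Fin 5) (l : List ℕ), refuteStep D n v s k l =
      Option.rec (some l) (fun t => refute D n l t) (propagate D 1000 (restrictColour v k s)) := by
    intro k l
    simp only [refuteStep]
    cases propagate D 1000 (restrictColour v k s) <;> rfl
  have bind : ∀ (o : Option (List ℕ)) (g : List ℕ → Option (List ℕ)),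
      o.bind g = Option.rec none g o := by
    intro o g; cases o <;> rfl
  simp only [bind, step]
  rfl

/-- The branch for the actual colour `f v` preserves soundness, so it can neither end in a conflict
nor be refuted recursively. -/
theorem not_sound_of_refute {D : List ℕ} {f : ℕ → Fin 5}
    (hf : ∀ v, ∀ d ∈ D, f v ≠ f (v ^^^ d)) {n : ℕ} {l l' : List ℕ} {s : MaskState}
    (h : refute D n l s = some l') : ¬ s.Sound f := by
  induction n generalizing l l' s with
  | zero => exact absurd h (by simp [refute])
  | succ n ih =>
    intro hs
    cases l with
    | nil => exact absurd h (by simp [refute])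
    | cons v l =>
      have step : ∀ {k : Fin 5} {l l' : List ℕ}, refuteStep D n v s k l = some l' → f v ≠ k := by
        intro k l l' h hk
        obtain ⟨t, ht, hts⟩ := (hs.restrictColour hk).propagate hf (n := 1000)
        rw [refuteStep, ht] at h
        exact ih h hts
      rw [refute_cons] at h
      simp only [Option.bind_eq_some_iff] at h
      obtain ⟨l1, h0, l2, h1, l3, h2, l4, h3, h4⟩ := h
      have hcol : ∀ x : Fin 5, x = 0 ∨ x = 1 ∨ x = 2 ∨ x = 3 ∨ x = 4 := by decide
      rcases hcol (f v) with h | h | h | h | h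
      · exact step h0 h
      · exact step h1 h
      · exact step h2 h
      · exact step h3 h
      · exact step h4 h

theorem not_refutes {D : List ℕ} {f : ℕ → Fin 5} (hf : ∀ v, ∀ d ∈ D, f v ≠ f (v ^^^ d))
    {init : List (ℕ × Fin 5)} (hinit : ∀ p ∈ init, f p.1 = p.2) {l : List ℕ}
    (h : refutes D init l = true) : False := by
  have hs : (init.foldr (fun p s => restrictColour p.1 p.2 s) ⟨0, 0, 0, 0, 0, 0⟩).Sound f := by
    clear h
    induction init with
    | nil => intro v; simp
    | cons p init ih =>
      exact (ih fun q hq => hinit q (by simp [hq])).restrictColour (hinit p (by simp))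
  obtain ⟨t, ht, hts⟩ := hs.propagate hf (n := 1000)
  rw [refutes, ht] at h
  obtain ⟨l', hl'⟩ := Option.isSome_iff_exists.1 h
  exact not_sound_of_refute hf hl' hts

/-! ### Confusion graphs -/

theorem confusionGraph_ofGraph_compl_adj {V : Type*} (G : SimpleGraph V) (x y : V → Bool) :
    (DirectedHypergraph.ofGraph Gᶜ).confusionGraph.Adj x y ↔
      ∃ i, x i ≠ y i ∧ ∀ j, j ≠ i → ¬ G.Adj i j → x j = y j := by
  constructor
  · rintro ⟨-, ⟨i, J⟩, hJ, hi, h⟩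
    obtain rfl : J = (Gᶜ).neighborSet i := hJ
    exact ⟨i, hi, fun j hj hij => h j ⟨hj.symm, hij⟩⟩
  · rintro ⟨i, hi, h⟩
    exact ⟨fun hxy => hi (congrFun hxy i), (i, (Gᶜ).neighborSet i), rfl, hi,
      fun j hj => h j (Ne.symm hj.1) hj.2⟩

/-! ### Homomorphisms between confusion graphs. -/

/-- The word obtained by adding up, modulo `2`, the letters in each fibre of a map. -/
def fibreParity {V W : Type*} [Fintype V] [DecidableEq W] (p : V → W) (x : V → Bool) (w : W) :
    Bool :=
  (∑ i with p i = w, (x i).toNat).bodd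

theorem fibreParity_congr {V W : Type*} [Fintype V] [DecidableEq W] {p : V → W} {x y : V → Bool}
    {w : W} (h : ∀ i, p i = w → x i = y i) : fibreParity p x w = fibreParity p y w := by
  unfold fibreParity
  congr 1
  refine Finset.sum_congr rfl fun i hi => ?_
  rw [h i (Finset.mem_filter.1 hi).2]

theorem fibreParity_ne {V W : Type*} [Fintype V] [DecidableEq W] {p : V → W}
    {x y : V → Bool} {i : V} (hi : x i ≠ y i) (h : ∀ j, j ≠ i → p j = p i → x j = y j) :
    fibreParity p x (p i) ≠ fibreParity p y (p i) := by
  classical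
  have key : ∀ z : V → Bool, fibreParity p z (p i) =
      xor (z i) (∑ j ∈ (Finset.univ.filter fun j => p j = p i).erase i, (z j).toNat).bodd := by
    intro z
    rw [fibreParity, ← Finset.add_sum_erase _ _ (show i ∈ _ by simp), Nat.bodd_add]
    cases z i <;> rfl
  rw [key, key, Finset.sum_congr rfl (g := fun j => (y j).toNat)]
  · intro hxy
    exact hi (Bool.xor_left_inj.1 hxy)
  · intro j hj
    simp only [Finset.mem_erase, Finset.mem_filter, Finset.mem_univ, true_and] at hj
    rw [h j hj.1 hj.2]

/-- A graph homomorphism induces a homomorphism of the confusion graphs of the complements. -/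
def confusionHom {V W : Type*} [Fintype V] [DecidableEq W] {G : SimpleGraph V} {H : SimpleGraph W}
    (p : G →g H) : (DirectedHypergraph.ofGraph Gᶜ).confusionGraph →g
      (DirectedHypergraph.ofGraph Hᶜ).confusionGraph where
  toFun := fibreParity p
  map_rel' := by
    intro x y hxy
    rw [confusionGraph_ofGraph_compl_adj] at hxy ⊢
    obtain ⟨i, hi, h⟩ := hxy
    -- The fibre of `p i` contains no neighbour of `i`, so only the letter at `i` changes in it and
    -- its parity flips. A fibre over a vertex neither equal nor adjacent to `p i` contains no
    -- changed letter.
    refine ⟨p i, fibreParity_ne hi fun j hj hji => h j hj fun hij => (p.map_adj hij).ne hji.symm,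
      fun w hw hiw => fibreParity_congr fun j hj => h j ?_ fun hij => hiw ?_⟩
    · rintro rfl
      exact hw hj.symm
    · rw [← hj]
      exact p.map_adj hij

theorem cycleGraph_adj_iff {m : ℕ} (hm : 2 ≤ m) (i j : Fin m) :
    (SimpleGraph.cycleGraph m).Adj i j ↔
      j.val = i.val + 1 ∨ i.val = j.val + 1 ∨ (i.val = 0 ∧ j.val + 1 = m) ∨
        (j.val = 0 ∧ i.val + 1 = m) := by
  obtain ⟨n, rfl⟩ := Nat.exists_eq_add_of_le' hm
  rw [SimpleGraph.cycleGraph_adj]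
  have key : ∀ a b : Fin (n + 2), a - b = 1 ↔ a.val = b.val + 1 ∨ (a.val = 0 ∧ b.val + 1 = n + 2) := by
    intro a b
    rw [sub_eq_iff_eq_add, Fin.ext_iff, Fin.val_add, Fin.val_one, Nat.add_comm 1]
    have ha := a.isLt; have hb := b.isLt
    by_cases h : b.val + 1 = n + 2
    · rw [show b.val + 1 = n + 2 from h, Nat.mod_self]; omega
    · rw [Nat.mod_eq_of_lt (by omega)]; omega
  rw [key, key]
  omega

/-- The cycle of length `k + 2 * l` wraps around the last two vertices of the cycle of length `k`. -/
def cycleFold {k m : ℕ} (hk : 3 ≤ k) (hkm : k ≤ m) (h : Even (m - k)) :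
    SimpleGraph.cycleGraph m →g SimpleGraph.cycleGraph k where
  -- The surplus vertices go alternately to `0` and `1`. As their number is even, the last one goes
  -- to `1`, which is adjacent to the image of vertex `0`.
  toFun i := if hi : i.val < k then ⟨i, hi⟩ else ⟨(i.val - k) % 2, by omega⟩
  map_rel' := by
    intro i j hij
    rw [cycleGraph_adj_iff (by omega)] at hij ⊢
    obtain ⟨t, ht⟩ := h
    have hi := i.isLt
    have hj := j.isLt
    split_ifs <;> simp only <;> omega

theorem confusionAntihole_colorable_of_le {k m c : ℕ} (hk : 3 ≤ k) (hkm : k ≤ m)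
    (h : Even (m - k)) (hc : (confusionAntihole k).Colorable c) :
    (confusionAntihole m).Colorable c :=
  hc.of_hom (confusionHom (cycleFold hk hkm h))

/-! ### Colourings of the confusion graph of an antihole

The vertices of the cycle of length `2 * n + 1` are numbered by `ZMod (2 * n + 1)` in such a way that
the neighbours of `k` are `k + n` and `k - n`. -/

section ConfusionColouring

variable {n : ℕ} {α : Type*}

/-- The word with a single nonzero letter. -/
def letter {m : ℕ} (k : ZMod m) : ZMod m → ZMod 2 := Pi.single k 1

/-- A colouring of the words that separates any two words that differ in `k` and agree outside
`k - n`, `k`, `k + n`. -/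
structure IsConfusionColouring (f : (ZMod (2 * n + 1) → ZMod 2) → α) : Prop where
  one : ∀ (x) (k : ZMod (2 * n + 1)), f x ≠ f (x + letter k)
  two : ∀ (x) (k : ZMod (2 * n + 1)), f x ≠ f (x + (letter k + letter (k + (n : ZMod (2 * n + 1)))))
  three : ∀ (x) (k : ZMod (2 * n + 1)), f x ≠ f (x + (letter k + letter (k + (n : ZMod (2 * n + 1))) +
    letter (k - (n : ZMod (2 * n + 1)))))

theorem two_mul_add_one_eq_zero (n : ℕ) : (2 * n + 1 : ZMod (2 * n + 1)) = 0 := by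
  have := ZMod.natCast_self (2 * n + 1)
  push_cast at this
  exact this

theorem ZMod.natCast_eq_add_one_or {m : ℕ} (hm : 2 ≤ m) (i j : Fin m)
    (h : (j.val : ZMod m) = i.val + 1 ∨ (j.val : ZMod m) = i.val - 1) :
    (SimpleGraph.cycleGraph m).Adj i j := by
  have key : ∀ a b : Fin m, (a.val : ZMod m) = b.val + 1 →
      a.val = b.val + 1 ∨ (a.val = 0 ∧ b.val + 1 = m) := by
    intro a b hab
    have hab' : (a.val : ZMod m) = (b.val + 1 : ℕ) := by push_cast; exact hab
    rw [ZMod.natCast_eq_natCast_iff'] at hab'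
    have ha := a.isLt
    have hb := b.isLt
    rw [Nat.mod_eq_of_lt ha] at hab'
    by_cases h : b.val + 1 = m
    · rw [h, Nat.mod_self] at hab'; omega
    · rw [Nat.mod_eq_of_lt (by omega)] at hab'; omega
  rw [cycleGraph_adj_iff hm]
  rcases h with h | h
  · have := key j i h; omega
  · have := key i j (by rw [h]; ring); omega

theorem exists_isConfusionColouring (hn : 1 ≤ n)
    (C : (confusionAntihole (2 * n + 1)).Coloring α) :
    ∃ f : (ZMod (2 * n + 1) → ZMod 2) → α, IsConfusionColouring f := by
  have two := two_mul_add_one_eq_zero n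
  -- `n + 1` is the inverse of `2` modulo `2 * n + 1`, and it equals `-n`; hence the steps `±1` on
  -- the cycle become `∓n`.
  let pos : Fin (2 * n + 1) → ZMod (2 * n + 1) := fun j => (n + 1) * (j.val : ZMod (2 * n + 1))
  have key : ∀ (x y : ZMod (2 * n + 1) → ZMod 2) (k : ZMod (2 * n + 1)), y k = x k + 1 →
      (∀ l, l ≠ k → l ≠ k + n → l ≠ k - n → y l = x l) →
      C (fun j => decide (x (pos j) = 1)) ≠ C (fun j => decide (y (pos j) = 1)) := by
    intro x y k hk hl
    apply C.valid
    refine (confusionGraph_ofGraph_compl_adj _ _ _).2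
      ⟨⟨(2 * k).val, ZMod.val_lt _⟩, ?_, fun j hj hij => ?_⟩
    · have : pos ⟨(2 * k).val, ZMod.val_lt _⟩ = k := by
        simp only [pos, ZMod.natCast_zmod_val]
        linear_combination k * two
      simp only [this, hk]
      generalize x k = a
      revert a
      decide
    · have hpos : (j.val : ZMod (2 * n + 1)) = 2 * pos j := by
        simp only [pos]
        linear_combination (-(j.val : ZMod (2 * n + 1))) * two
      rw [hl]
      · intro h
        apply hj
        rw [Fin.ext_iff]
        simp only
        rw [← h, ← hpos, ZMod.val_natCast, Nat.mod_eq_of_lt j.isLt]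
      · intro h
        apply hij
        apply ZMod.natCast_eq_add_one_or (by omega)
        right
        simp only [ZMod.natCast_zmod_val]
        rw [hpos, h]
        linear_combination two
      · intro h
        apply hij
        apply ZMod.natCast_eq_add_one_or (by omega)
        left
        simp only [ZMod.natCast_zmod_val]
        rw [hpos, h]
        linear_combination -two
  have hne : ∀ k : ZMod (2 * n + 1), k ≠ k + n ∧ k ≠ k - n := by
    intro k
    have h0 : (n : ZMod (2 * n + 1)) ≠ 0 := by
      intro h
      rw [ZMod.natCast_eq_zero_iff] at h
      have := Nat.le_of_dvd (by omega) h
      omega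
    constructor
    · intro h; apply h0; linear_combination -h
    · intro h; apply h0; linear_combination h
  refine ⟨fun x => C (fun j => decide (x (pos j) = 1)), ?_, ?_, ?_⟩
  · intro x k
    apply key _ _ k
    · simp [letter]
    · intro l h1 h2 h3
      simp [letter, h1]
  · intro x k
    apply key _ _ k
    · simp [letter, (hne k).1]
    · intro l h1 h2 h3
      simp [letter, h1, h2]
  · intro x k
    apply key _ _ k
    · simp [letter, (hne k).1, (hne k).2]
    · intro l h1 h2 h3
      simp [letter, h1, h2, h3]

namespace IsConfusionColouring

theorem word_add_self {m : ℕ} (x : ZMod m → ZMod 2) : x + x = 0 := by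
  funext k
  exact CharTwo.add_self_eq_zero _

variable {f : (ZMod (2 * n + 1) → ZMod 2) → α}

/-- The words in a coset of the group generated by `letter k`, `letter (k + 1)` and
`letter (k + n + 1)` have the same colour only if they differ by `letter k + letter (k + 1)`. -/
theorem cube (hf : IsConfusionColouring f) (x : ZMod (2 * n + 1) → ZMod 2) (k : ZMod (2 * n + 1)) :
    let c : ZMod (2 * n + 1) := k + n + 1
    let h := letter k + letter (k + 1)
    ∀ s ∈ ({0, h} : Set (ZMod (2 * n + 1) → ZMod 2)), ∀ t ∈ ({0, h} : Set _),
      ∀ d ∈ ({letter k, letter c, letter k + letter c} : Set _),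
      f (x + s) ≠ f (x + (t + d)) := by
  have h1 := hf.one
  have h2 := hf.two
  have h3 := hf.three
  have e1 : k + n + 1 + n = k := by linear_combination two_mul_add_one_eq_zero n
  have e2 : k + n + 1 - n = k + 1 := by ring
  have e3 : k + 1 + n = k + n + 1 := by ring
  have two := word_add_self (letter k)
  have two' := word_add_self (letter (k + 1))
  set u := letter k
  set v := letter (k + 1)
  set c := letter (k + (n : ZMod (2 * n + 1)) + 1)
  have hu : ∀ y, f y ≠ f (y + u) := fun y => h1 y k
  have hv : ∀ y, f y ≠ f (y + v) := fun y => h1 y (k + 1)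
  have hc : ∀ y, f y ≠ f (y + c) := fun y => h1 y (k + n + 1)
  have hcu : ∀ y, f y ≠ f (y + (c + u)) := fun y => by
    have := h2 y (k + n + 1); rwa [e1] at this
  have hvc : ∀ y, f y ≠ f (y + (v + c)) := fun y => by
    have := h2 y (k + 1); rwa [e3] at this
  have ht : ∀ y, f y ≠ f (y + (c + u + v)) := fun y => by
    have := h3 y (k + n + 1); rwa [e1, e2] at this
  intro _ h s hs t ht' d hd
  have aux : ∀ w, f (x + s) ≠ f (x + s + w) → x + s + w = x + (t + d) → f (x + s) ≠ f (x + (t + d)) :=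
    fun w hw e => e ▸ hw
  rcases hs with rfl | rfl <;> rcases ht' with rfl | rfl <;> rcases hd with rfl | rfl | rfl
  · exact aux _ (hu _) (by ring)
  · exact aux _ (hc _) (by ring)
  · exact aux _ (hcu _) (by ring)
  · exact aux _ (hv _) (by linear_combination -two)
  · exact aux _ (ht _) (by ring)
  · exact aux _ (hvc _) (by linear_combination -two)
  · exact aux _ (hv _) (by linear_combination two')
  · exact aux _ (ht _) (by linear_combination two + two')
  · exact aux _ (hvc _) (by linear_combination two')
  · exact aux _ (hu _) (by ring)
  · exact aux _ (hc _) (by ring)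
  · exact aux _ (hcu _) (by ring)

end IsConfusionColouring

end ConfusionColouring

/-! ### Lower bounds by counting colour changes. -/

section RimChanges

variable {n : ℕ} {α : Type*} [DecidableEq α]

/-- The positions at which the colours of `x + letter k`, in cyclic order, change. -/
def rimChanges (f : (ZMod (2 * n + 1) → ZMod 2) → α) (x : ZMod (2 * n + 1) → ZMod 2) :
    Finset (ZMod (2 * n + 1)) :=
  Finset.univ.filter fun k => f (x + letter k) ≠ f (x + letter (k + 1))

theorem card_pair_eq (a b : α) : ({a, b} : Finset α).card = 1 + if a ≠ b then 1 else 0 := by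
  split_ifs with h
  · rw [Finset.card_pair h]
  · rw [not_not] at h
    simp [h]

namespace IsConfusionColouring

variable {f : (ZMod (2 * n + 1) → ZMod 2) → α}

/-- By `cube`, the four pairs `{y, y + letter k + letter (k + 1)}` in the coset have disjoint colour
sets, each of size one plus the indicator `bad`. -/
theorem sum_cube_le [Fintype α] (hf : IsConfusionColouring f) (x : ZMod (2 * n + 1) → ZMod 2)
    (k : ZMod (2 * n + 1)) :
    let c : ZMod (2 * n + 1) := k + n + 1
    let bad : (ZMod (2 * n + 1) → ZMod 2) → ℕ := fun y =>
      if f y ≠ f (y + (letter k + letter (k + 1))) then 1 else 0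
    bad x + bad (x + letter k) + bad (x + letter c) + bad (x + (letter k + letter c)) + 4 ≤
      Fintype.card α := by
  intro c bad
  let S : (ZMod (2 * n + 1) → ZMod 2) → Finset α := fun y =>
    {f y, f (y + (letter k + letter (k + 1)))}
  have hS : ∀ y, (S y).card = 1 + bad y := fun y => card_pair_eq _ _
  have hdis : ∀ y, ∀ d ∈ ({letter k, letter c, letter k + letter c} : Set _),
      Disjoint (S y) (S (y + d)) := by
    intro y d hd
    have h := fun s hs t ht => hf.cube y k s hs t ht d hd
    have e : ∀ t, y + d + t = y + (t + d) := fun t => by ring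
    simp only [Set.mem_insert_iff, Set.mem_singleton_iff, forall_eq_or_imp, forall_eq] at h
    simp only [S, Finset.disjoint_left, Finset.mem_insert, Finset.mem_singleton, e]
    simp only [zero_add, add_zero] at h
    rintro a (rfl | rfl)
    · exact fun h' => h'.elim h.1.1 h.1.2
    · exact fun h' => h'.elim h.2.1 h.2.2
  have two := word_add_self (letter k)
  have d12 := hdis x (letter k) (by simp)
  have d13 := hdis x (letter c) (by simp)
  have d14 := hdis x (letter k + letter c) (by simp)
  have d23 := hdis (x + letter k) (letter k + letter c) (by simp)
  have d24 := hdis (x + letter k) (letter c) (by simp)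
  have d34 := hdis (x + letter c) (letter k) (by simp)
  rw [show x + letter k + (letter k + letter c) = x + letter c by linear_combination two] at d23
  rw [add_assoc] at d24
  rw [show x + letter c + letter k = x + (letter k + letter c) by ring] at d34
  have hcard := Finset.card_le_univ
    (S x ∪ S (x + letter k) ∪ S (x + letter c) ∪ S (x + (letter k + letter c)))
  rw [Finset.card_union_of_disjoint, Finset.card_union_of_disjoint,
    Finset.card_union_of_disjoint d12, hS, hS, hS, hS] at hcard
  · omega
  · exact Finset.disjoint_union_left.2 ⟨d13, d23⟩
  · exact Finset.disjoint_union_left.2 ⟨Finset.disjoint_union_left.2 ⟨d14, d24⟩, d34⟩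

/-- If the colours change at least `r` times around every word, then there are at least
`4 + 4 * r / (2 * n + 1)` colours. -/
theorem le_card_of_le_rimChanges [Fintype α] (hf : IsConfusionColouring f) {r : ℕ}
    (hr : ∀ x, r ≤ (rimChanges f x).card) :
    4 * r + 4 * (2 * n + 1) ≤ (2 * n + 1) * Fintype.card α := by
  let W := ZMod (2 * n + 1) → ZMod 2
  let bad : ZMod (2 * n + 1) → W → ℕ := fun k y =>
    if f y ≠ f (y + (letter k + letter (k + 1))) then 1 else 0
  have hshift : ∀ (k) (d : W), ∑ y, bad k (y + d) = ∑ y, bad k y := fun k d =>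
    Fintype.sum_equiv (Equiv.addRight d) _ _ fun _ => rfl
  have hbad : ∀ k, 4 * ∑ y, bad k y + 4 * Fintype.card W ≤ Fintype.card W * Fintype.card α := by
    intro k
    have h := Finset.sum_le_sum fun (x : W) (_ : x ∈ Finset.univ) => hf.sum_cube_le x k
    simp only [Finset.sum_add_distrib, Finset.sum_const, Finset.card_univ, smul_eq_mul] at h
    have h1 := hshift k (letter k)
    have h2 := hshift k (letter (k + (n : ZMod (2 * n + 1)) + 1))
    have h3 := hshift k (letter k + letter (k + (n : ZMod (2 * n + 1)) + 1))
    simp only [bad] at h1 h2 h3 ⊢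
    rw [h1, h2, h3] at h
    linarith
  have hsum : ∑ x : W, (rimChanges f x).card = ∑ k, ∑ y : W, bad k y := by
    -- A change at `k` around `x` is a bichromatic pair based at `x + letter k`; summing over `x`
    -- absorbs the translation.
    have : ∀ x : W, (rimChanges f x).card = ∑ k, bad k (x + letter k) := by
      intro x
      rw [rimChanges, Finset.card_filter]
      refine Finset.sum_congr rfl fun k _ => ?_
      have e : x + letter k + (letter k + letter (k + 1)) = x + letter (k + 1) := by
        linear_combination word_add_self (letter k)
      simp only [bad, e]
    simp only [this]
    rw [Finset.sum_comm]
    rw [Finset.sum_congr rfl fun k _ => hshift k (letter k)]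
  have h1 : Fintype.card W * r ≤ ∑ x : W, (rimChanges f x).card := by
    have := Finset.sum_le_sum fun (x : W) (_ : x ∈ Finset.univ) => hr x
    simpa using this
  have h2 := Finset.sum_le_sum fun k (_ : k ∈ Finset.univ) => hbad k
  rw [Finset.sum_add_distrib, ← Finset.mul_sum, ← hsum] at h2
  simp only [Finset.sum_const, Finset.card_univ, smul_eq_mul, ZMod.card] at h2
  have hW : 0 < Fintype.card W := Fintype.card_pos
  refine Nat.le_of_mul_le_mul_left ?_ hW
  nlinarith

/-- The colours cannot stay the same along `n` consecutive positions of the rim. -/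
theorem exists_mem_rimChanges (hf : IsConfusionColouring f) (x : ZMod (2 * n + 1) → ZMod 2)
    (k : ZMod (2 * n + 1)) : ∃ j < n, k + (j : ZMod (2 * n + 1)) ∈ rimChanges f x := by
  by_contra! h
  have key : ∀ j ≤ n, f (x + letter (k + (j : ZMod (2 * n + 1)))) = f (x + letter k) := by
    intro j hj
    induction j with
    | zero => simp
    | succ j ih =>
      rw [← ih (by omega)]
      have := h j (by omega)
      simp only [rimChanges, Finset.mem_filter, Finset.mem_univ, true_and, not_not] at this
      rw [this]
      push_cast
      rw [add_assoc]
  -- `x + letter k` and `x + letter (k + n)` differ in two adjacent positions, so they are confused.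
  have h2 := hf.two (x + letter k) k
  rw [show x + letter k + (letter k + letter (k + (n : ZMod (2 * n + 1)))) =
    x + letter (k + (n : ZMod (2 * n + 1))) by linear_combination word_add_self (letter k),
    key n le_rfl] at h2
  exact h2 rfl

end IsConfusionColouring

theorem not_colorable_four (hn : 1 ≤ n) : ¬ (confusionAntihole (2 * n + 1)).Colorable 4 := by
  rintro ⟨C⟩
  obtain ⟨f, hf⟩ := exists_isConfusionColouring hn C
  have h := hf.le_card_of_le_rimChanges (r := 1) fun x => by
    obtain ⟨j, -, hj⟩ := hf.exists_mem_rimChanges x 0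
    exact Finset.card_pos.2 ⟨_, hj⟩
  rw [Fintype.card_fin] at h
  omega

/-- A set meeting every two consecutive residues modulo `5` has at least three elements, and `4 * 3
+ 4 * 5 = 32 > 5 * 6`. -/
theorem not_colorable_six_five : ¬ (confusionAntihole 5).Colorable 6 := by
  rintro ⟨C⟩
  obtain ⟨f, hf⟩ := exists_isConfusionColouring (n := 2) (by norm_num) C
  have h := hf.le_card_of_le_rimChanges (r := 3) fun x => by
    have h := hf.exists_mem_rimChanges x
    have key : ∀ B : Finset (ZMod 5), (∀ k, ∃ j : ℕ, j < 2 ∧ k + (j : ZMod 5) ∈ B) → 3 ≤ B.card := by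
      decide +kernel
    exact key _ h
  rw [Fintype.card_fin] at h
  omega

end RimChanges

/-! ### No five colours for the cycle of length 15. -/

section Fifteen

/-- The ends of the first two of three arcs of lengths at most `7` that make up `15` positions. -/
def arcEnds : List (ℕ × ℕ) := [(5, 10), (6, 11), (6, 12), (7, 11), (7, 12), (7, 13), (7, 14)]

theorem not_refutes_arcs {p : ℕ × ℕ} (hp : p ∈ arcEnds) {F : ℕ → Fin 5}
    (hF : ∀ v, ∀ d ∈ antiholeShifts, F v ≠ F (v ^^^ d))
    (hinit : ∀ t ∈ arcColours p.1 p.2, F t.1 = t.2) : False := by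
  simp only [arcEnds, List.mem_cons, List.not_mem_nil, or_false] at hp
  rcases hp with rfl | rfl | rfl | rfl | rfl | rfl | rfl
  · exact not_refutes hF hinit refutes_arcs_5_10
  · exact not_refutes hF hinit refutes_arcs_6_11
  · exact not_refutes hF hinit refutes_arcs_6_12
  · exact not_refutes hF hinit refutes_arcs_7_11
  · exact not_refutes hF hinit refutes_arcs_7_12
  · exact not_refutes hF hinit refutes_arcs_7_13
  · exact not_refutes hF hinit refutes_arcs_7_14

set_option synthInstance.maxHeartbeats 400000 in
set_option synthInstance.maxSize 4096 in
/-- Up to rotation and reflection, three changes of colour leave one of the lists of arcs. -/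
theorem exists_arcEnds_of_pair : ∀ b c : ZMod 15,
    (∀ k : ZMod 15, ∃ j : ℕ, j < 7 ∧ (k + j = 0 ∨ k + j = b ∨ k + j = c)) →
    ∃ s : ZMod 15, ∃ r ∈ [((1 : ZMod 15), (0 : ZMod 15)), (-1, -1)], ∃ p ∈ arcEnds,
      ∀ i : ℕ, i < 14 → i + 1 ≠ p.1 → i + 1 ≠ p.2 → s + r.1 * i + r.2 ≠ 0 ∧ s + r.1 * i + r.2 ≠ b ∧ s + r.1 * i + r.2 ≠ c := by
  decide +kernel

theorem exists_perm_colours : ∀ a b c d : Fin 5, a ≠ b → a ≠ c → a ≠ d → b ≠ c → b ≠ d →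
    c ≠ d → ∃ g : Equiv.Perm (Fin 5), g a = 0 ∧ g b = 1 ∧ g c = 2 ∧ g d = 4 := by
  decide +kernel

/-- Any two of the arcs contain positions at cyclic distance `7`, which are neighbours. This forces
the three arcs to have distinct colours. -/
theorem arcEnds_distances : ∀ p ∈ arcEnds,
    (∃ i < p.1, ∃ j < 15, p.1 ≤ j ∧ j < p.2 ∧ (j = i + 7 ∨ j = i + 8)) ∧
    (∃ i < p.1, ∃ j < 15, p.2 ≤ j ∧ (j = i + 7 ∨ j = i + 8)) ∧
    (∃ i < p.2, p.1 ≤ i ∧ ∃ j < 15, p.2 ≤ j ∧ (j = i + 7 ∨ j = i + 8)) := by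
  decide +kernel

theorem arcEnds_lt : ∀ p ∈ arcEnds, p.1 < p.2 ∧ p.2 < 15 ∧ 0 < p.1 := by
  decide

theorem mem_antiholeShifts : ∀ d ∈ antiholeShifts, ∃ i < 15, d = 2 ^ i ∨
    d = 2 ^ i ^^^ 2 ^ ((i + 7) % 15) ∨ d = 2 ^ i ^^^ 2 ^ ((i + 7) % 15) ^^^ 2 ^ ((i + 8) % 15) := by
  decide +kernel

/-- The word whose letters at the positions `t 0`, …, `t 14` are the binary digits of a number. -/
def digitWord (t : ℕ → ZMod 15) (v : ℕ) : ZMod 15 → ZMod 2 :=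
  ∑ i ∈ Finset.range 15, if v.testBit i then letter (t i) else 0

theorem digitWord_xor (t : ℕ → ZMod 15) (v w : ℕ) :
    digitWord t (v ^^^ w) = digitWord t v + digitWord t w := by
  unfold digitWord
  rw [← Finset.sum_add_distrib]
  refine Finset.sum_congr rfl fun i _ => ?_
  rw [Nat.testBit_xor]
  cases v.testBit i <;> cases w.testBit i <;> simp [IsConfusionColouring.word_add_self]

theorem digitWord_two_pow (t : ℕ → ZMod 15) {i : ℕ} (hi : i < 15) :
    digitWord t (2 ^ i) = letter (t i) := by
  unfold digitWord
  simp [Nat.testBit_two_pow, hi]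

theorem digitWord_zero (t : ℕ → ZMod 15) : digitWord t 0 = 0 := by
  simp [digitWord]

/-- With at most three changes, the words around `x` form three arcs with distinct colours, all
different from the colour of `x`. After rotation, reflection and a permutation of the colours, this
is an initial state that the search refutes. -/
theorem IsConfusionColouring.four_le_card_rimChanges
    {f : (ZMod (2 * 7 + 1) → ZMod 2) → Fin 5} (hf : IsConfusionColouring f)
    (x : ZMod (2 * 7 + 1) → ZMod 2) : 4 ≤ (rimChanges f x).card := by
  by_contra! hlt
  have hwin := hf.exists_mem_rimChanges x
  obtain ⟨a, ha⟩ : (rimChanges f x).Nonempty := by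
    obtain ⟨j, -, hj⟩ := hwin 0
    exact ⟨_, hj⟩
  -- Measuring positions from the change `a` leaves only two free parameters for the finite check.
  obtain ⟨b, c, hbc⟩ : ∃ b c, rimChanges f x ⊆ {a, a + b, a + c} := by
    obtain ⟨T, hT, hT2⟩ := Finset.exists_superset_card_eq (s := (rimChanges f x).erase a) (n := 2)
      (by rw [Finset.card_erase_of_mem ha]; omega) (by rw [ZMod.card]; norm_num)
    obtain ⟨b, c, -, rfl⟩ := Finset.card_eq_two.1 hT2
    refine ⟨b - a, c - a, fun k hk => ?_⟩
    by_cases hka : k = a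
    · simp [hka]
    · have := hT (Finset.mem_erase.2 ⟨hka, hk⟩)
      simpa [hka] using this
  obtain ⟨s, r, hr, p, hp, hcon⟩ := exists_arcEnds_of_pair b c fun k => by
    obtain ⟨j, hj, hk⟩ := hwin (a + k)
    refine ⟨j, hj, ?_⟩
    have := hbc hk
    simp only [Finset.mem_insert, Finset.mem_singleton] at this
    rcases this with h | h | h
    · left; linear_combination h
    · right; left; linear_combination h
    · right; right; linear_combination h
  have hr' : r = (1, 0) ∨ r = (-1, -1) := by simpa using hr
  -- `r.1 = ±1` is the direction of travel. In reverse, the step from `t i` to `t (i + 1) = t i - 1`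
  -- is a change indexed by `t i - 1`, whence `r.2 = -1`.
  let t : ℕ → ZMod 15 := fun i => a + s + r.1 * i
  let u : ℕ → Fin 5 := fun i => f (x + letter (t i))
  have hsame : ∀ i < 14, i + 1 ≠ p.1 → i + 1 ≠ p.2 → u (i + 1) = u i := by
    intro i hi h1 h2
    have hnot : a + (s + r.1 * i + r.2) ∉ rimChanges f x := fun hmem => by
      have h3 := hbc hmem
      have h4 := hcon i hi h1 h2
      simp only [Finset.mem_insert, Finset.mem_singleton, add_right_inj, add_eq_left] at h3
      tauto
    simp only [rimChanges, Finset.mem_filter, Finset.mem_univ, true_and, not_not] at hnot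
    simp only [u, t]
    rcases hr' with rfl | rfl
    · rw [show a + s + (1, (0 : ZMod 15)).1 * ((i : ℕ) : ZMod 15) =
        a + (s + (1, (0 : ZMod 15)).1 * (i : ZMod 15) + (1, (0 : ZMod 15)).2) by simp; ring, hnot]
      congr 3
      push_cast
      ring
    · rw [show a + s + (-1, (-1 : ZMod 15)).1 * ((i + 1 : ℕ) : ZMod 15) =
        a + (s + (-1, (-1 : ZMod 15)).1 * (i : ZMod 15) + (-1, (-1 : ZMod 15)).2) by
          push_cast; ring, hnot]
      congr 3
      ring
  obtain ⟨hp1, hp2, hp0⟩ := arcEnds_lt p hp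
  have harc : ∀ i < 15, u i = if i < p.1 then u 0 else if i < p.2 then u p.1 else u p.2 := by
    intro i hi
    induction i with
    | zero => simp [hp0]
    | succ i ih =>
      by_cases h1 : i + 1 = p.1
      · simp [h1, hp1]
      by_cases h2 : i + 1 = p.2
      · simp [h2, hp1.le]
      rw [hsame i (by omega) h1 h2, ih (by omega)]
      have e1 : i + 1 < p.1 ↔ i < p.1 := by omega
      have e2 : i + 1 < p.2 ↔ i < p.2 := by omega
      simp only [e1, e2]
  have hfar : ∀ i j, (j = i + 7 ∨ j = i + 8) → u i ≠ u j := by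
    have two : ∀ k l : ZMod 15, l = k + 7 → f (x + letter k) ≠ f (x + letter l) := by
      rintro k _ rfl
      have := hf.two (x + letter k) k
      rwa [show x + letter k + (letter k + letter (k + ((7 : ℕ) : ZMod (2 * 7 + 1)))) =
        x + letter (k + 7) by
          push_cast
          linear_combination word_add_self (letter k)] at this
    have h15 : (15 : ZMod 15) = 0 := by decide
    rintro i j (rfl | rfl) <;> rcases hr' with rfl | rfl
    · exact two _ _ (by simp only [t]; push_cast; ring)
    · exact (two _ _ (by simp only [t]; push_cast; ring)).symm
    · exact (two _ _ (by simp only [t]; push_cast; linear_combination -h15)).symm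
    · exact two _ _ (by simp only [t]; push_cast; linear_combination -h15)
  obtain ⟨⟨i1, hi1, j1, hj1, hj1', hj1'', d1⟩, ⟨i2, hi2, j2, hj2, hj2', d2⟩,
    ⟨i3, hi3, hi3', j3, hj3, hj3', d3⟩⟩ := arcEnds_distances p hp
  have n01 : u 0 ≠ u p.1 := by
    have := hfar i1 j1 d1
    rwa [harc i1 (by omega), harc j1 hj1, if_pos hi1, if_neg (by omega), if_pos hj1''] at this
  have n02 : u 0 ≠ u p.2 := by
    have := hfar i2 j2 d2
    rwa [harc i2 (by omega), harc j2 hj2, if_pos hi2, if_neg (by omega), if_neg (by omega)] at this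
  have n12 : u p.1 ≠ u p.2 := by
    have := hfar i3 j3 d3
    rwa [harc i3 (by omega), harc j3 hj3, if_neg (by omega), if_pos hi3, if_neg (by omega),
      if_neg (by omega)] at this
  have nx : ∀ i, u i ≠ f x := fun i => (hf.one x (t i)).symm
  obtain ⟨g, g0, g1, g2, g4⟩ := exists_perm_colours _ _ _ _ n01 n02 (nx 0) n12 (nx _) (nx _)
  -- `digitWord` ignores binary digits from place `15` on, so this colours all of `ℕ` and no bound
  -- on `v` is needed.
  refine not_refutes_arcs hp (F := fun v => g (f (x + digitWord t v))) ?_ ?_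
  · intro v d hd h
    have h := g.injective h
    rw [digitWord_xor, ← add_assoc] at h
    generalize x + digitWord t v = y at h
    obtain ⟨i, hi, hd⟩ := mem_antiholeShifts d hd
    have h15 : (15 : ZMod 15) = 0 := by decide
    have h7 : t ((i + 7) % 15) = t i + r.1 * 7 := by
      simp only [t]
      rw [ZMod.natCast_mod]
      push_cast
      ring
    have h8 : t ((i + 8) % 15) = t i - r.1 * 7 := by
      simp only [t]
      rw [ZMod.natCast_mod]
      push_cast
      linear_combination r.1 * h15
    have one := hf.one y (t i)
    have two := hf.two y (t i)
    -- In the reversed direction the pair `i`, `i + 7` becomes `t i`, `t i - 7`.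
    have two' := hf.two y (t i - 7)
    have three := hf.three y (t i)
    have e7 : ((7 : ℕ) : ZMod (2 * 7 + 1)) = (7 : ZMod 15) := rfl
    rw [e7] at two two' three
    rw [show t i - 7 + (7 : ZMod 15) = t i from sub_add_cancel _ _] at two'
    have m7 : (i + 7) % 15 < 15 := Nat.mod_lt _ (by norm_num)
    have m8 : (i + 8) % 15 < 15 := Nat.mod_lt _ (by norm_num)
    rcases hd with rfl | rfl | rfl <;>
      simp only [digitWord_xor, digitWord_two_pow t hi, digitWord_two_pow t m7,
        digitWord_two_pow t m8, h7, h8] at h <;> rcases hr' with rfl | rfl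
    · exact one h
    · exact one h
    · rw [one_mul] at h
      exact two h
    · rw [neg_one_mul, ← sub_eq_add_neg, add_comm (letter (t i))] at h
      exact two' h
    · rw [one_mul] at h
      exact three h
    · rw [neg_one_mul, ← sub_eq_add_neg, sub_neg_eq_add, add_right_comm] at h
      exact three h
  · intro q hq
    simp only [arcColours, List.mem_cons, List.mem_map, List.mem_range] at hq
    rcases hq with rfl | ⟨i, hi, rfl⟩
    · simp only [digitWord_zero, add_zero, g4]
    · simp only [digitWord_two_pow t hi]
      change g (u i) = _
      rw [harc i hi]
      split_ifs
      · exact g0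
      · exact g1
      · exact g2

theorem not_colorable_fifteen_five : ¬ (confusionAntihole 15).Colorable 5 := by
  rintro ⟨C⟩
  obtain ⟨f, hf⟩ := exists_isConfusionColouring (n := 7) (by norm_num) C
  have h := hf.le_card_of_le_rimChanges hf.four_le_card_rimChanges
  rw [Fintype.card_fin] at h
  omega

end Fifteen

/-! ### Fractional colourings from translates. -/

section Fractional

theorem fractionalChromaticNumber_le {V ι : Type*} [Fintype V] [Fintype ι] (G : SimpleGraph V)
    (I : ι → Finset V) (hI : ∀ t, G.IsIndepSet (I t : Set V)) {r : ℕ} (hr : 0 < r)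
    [DecidableEq V] (hcover : ∀ v, r ≤ (Finset.univ.filter fun t => v ∈ I t).card) :
    G.fractionalChromaticNumber ≤ Fintype.card ι / r := by
  classical
  have hr' : (0 : ℝ) < r := by exact_mod_cast hr
  let N : Finset V → ℕ := fun J => (Finset.univ.filter fun t => I t = J).card
  -- The family may repeat a set, so its weight is capped at `1`. A set reaching the cap covers its
  -- vertices alone; a vertex in no such set is covered by the uncapped count.
  let w : Finset V → ℝ := fun J => min 1 (N J / r)
  have hw0 : ∀ J, 0 ≤ w J := fun J => le_min zero_le_one (by positivity)
  have hsum : ∑ J, w J ≤ Fintype.card ι / r := by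
    have h1 : ∑ J, w J ≤ ∑ J, (N J : ℝ) / r := Finset.sum_le_sum fun J _ => min_le_right _ _
    refine h1.trans (le_of_eq ?_)
    rw [← Finset.sum_div, ← Nat.cast_sum]
    congr 2
    rw [← Finset.card_univ, Finset.card_eq_sum_card_fiberwise (f := I) (t := Finset.univ)]
    simp
  refine le_trans (csInf_le ⟨0, ?_⟩ ⟨w, ⟨hw0, fun J => min_le_left _ _, ?_, ?_⟩, rfl⟩) hsum
  · rintro s ⟨w', hw', rfl⟩
    exact Finset.sum_nonneg fun J _ => hw'.nonneg J
  · intro J hJ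
    have : N J = 0 := by
      rw [Finset.card_eq_zero, Finset.filter_eq_empty_iff]
      rintro t - rfl
      exact hJ (hI t)
    simp [w, this]
  · intro v
    suffices hv : 1 ≤ ∑ J ∈ Finset.univ.filter fun J : Finset V => v ∈ J, w J by convert hv
    by_cases h : ∃ J : Finset V, v ∈ J ∧ r ≤ N J
    · obtain ⟨J, hv, hJ⟩ := h
      have hJ1 : w J = 1 := min_eq_left ((one_le_div hr').2 (by exact_mod_cast hJ))
      rw [← hJ1]
      exact Finset.single_le_sum (f := w) (fun J _ => hw0 J) (by simp [hv])
    · push Not at h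
      have hwN : ∀ J ∈ Finset.univ.filter fun J : Finset V => v ∈ J, w J = N J / r := by
        intro J hJ
        have := h J (Finset.mem_filter.1 hJ).2
        exact min_eq_right ((div_le_one hr').2 (by exact_mod_cast this.le))
      rw [Finset.sum_congr rfl hwN, ← Finset.sum_div, one_le_div hr', ← Nat.cast_sum]
      norm_cast
      refine (hcover v).trans (le_of_eq ?_)
      rw [Finset.card_eq_sum_card_fiberwise (f := I)
        (t := Finset.univ.filter fun J : Finset V => v ∈ J) (by intro t ht; simpa using ht)]
      refine Finset.sum_congr rfl fun J hJ => ?_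
      congr 1
      ext t
      simp only [Finset.mem_filter, Finset.mem_univ, true_and] at hJ ⊢
      constructor
      · exact fun h => h.2
      · rintro rfl
        exact ⟨hJ, rfl⟩

/-- The translates of an independent set of words form a fractional colouring, which can be pulled
back along a homomorphism. -/
theorem fractionalChromaticNumber_le_of_hom {V U : Type*} [Fintype V] [Fintype U] [DecidableEq U]
    {G : SimpleGraph V} {H : SimpleGraph U} (p : G →g (DirectedHypergraph.ofGraph Hᶜ).confusionGraph)
    (S : Finset (U → Bool)) (hS : S.Nonempty)
    (hind : (DirectedHypergraph.ofGraph Hᶜ).confusionGraph.IsIndepSet (S : Set (U → Bool))) :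
    G.fractionalChromaticNumber ≤ 2 ^ Fintype.card U / S.card := by
  classical
  have h := fractionalChromaticNumber_le G
    (fun t : U → Bool => Finset.univ.filter fun v => (fun i => xor (p v i) (t i)) ∈ S) ?_ (r := S.card)
    (Finset.card_pos.2 hS) ?_
  · rw [Fintype.card_fun, Fintype.card_bool] at h
    exact_mod_cast h
  · intro t x hx y hy hxy hadj
    simp only [Finset.coe_filter, Finset.mem_univ, true_and, Set.mem_ofPred_eq] at hx hy
    have hadj' := p.map_adj hadj
    rw [confusionGraph_ofGraph_compl_adj] at hadj'
    obtain ⟨i, hi, h⟩ := hadj'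
    have hadj2 : (DirectedHypergraph.ofGraph Hᶜ).confusionGraph.Adj
        (fun i => xor (p x i) (t i)) (fun i => xor (p y i) (t i)) := by
      rw [confusionGraph_ofGraph_compl_adj]
      refine ⟨i, fun he => hi (Bool.xor_left_inj.1 he), fun j hj hij => ?_⟩
      simp only [h j hj hij]
    exact hind hx hy hadj2.ne hadj2
  · intro v
    refine le_of_eq ?_
    -- The translate by `t` contains `v` exactly when `t` is the sum of `p v` and some `s ∈ S`.
    refine Finset.card_bij (fun s _ i => xor (p v i) (s i)) ?_ ?_ ?_
    · intro s hs
      simpa using hs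
    · intro s _ s' _ he
      funext i
      exact Bool.xor_right_inj.1 (congrFun he i)
    · intro t ht
      simp only [Finset.mem_filter, Finset.mem_univ, true_and] at ht
      exact ⟨_, ht, by funext i; simp⟩

end Fractional

/-! ### A large independent set of words. -/

section IndependentSets

open scoped symmDiff

theorem card_symmDiff_add_two_mul {α : Type*} [DecidableEq α] (A B : Finset α) :
    (A ∆ B).card + 2 * (A ∩ B).card = A.card + B.card := by
  have h : A ∆ B = A \ B ∪ B \ A := rfl
  rw [h, Finset.card_union_of_disjoint disjoint_sdiff_sdiff]
  have h1 := Finset.card_sdiff_add_card_inter A B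
  have h2 := Finset.card_sdiff_add_card_inter B A
  rw [Finset.inter_comm] at h2
  omega

/-- The word that is the sum, modulo `2`, of the words with letters `k` and `k + 1`, for `k ∈ A`. -/
def edgeSum {m : ℕ} (A : Finset (ZMod m)) (j : Fin m) : Bool :=
  xor (decide ((j.val : ZMod m) ∈ A)) (decide ((j.val : ZMod m) - 1 ∈ A))

theorem edgeSum_eq_iff {m : ℕ} (A B : Finset (ZMod m)) (j : Fin m) :
    edgeSum A j = edgeSum B j ↔
      ((j.val : ZMod m) ∈ A ∆ B ↔ (j.val : ZMod m) - 1 ∈ A ∆ B) := by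
  unfold edgeSum
  simp only [Finset.mem_symmDiff]
  by_cases h1 : (j.val : ZMod m) ∈ A <;> by_cases h2 : (j.val : ZMod m) ∈ B <;>
    by_cases h3 : (j.val : ZMod m) - 1 ∈ A <;> by_cases h4 : (j.val : ZMod m) - 1 ∈ B <;>
    simp [h1, h2, h3, h4]

theorem cycleGraph_adj_natCast {m : ℕ} (hm : 2 ≤ m) {i j : Fin m}
    (h : (SimpleGraph.cycleGraph m).Adj i j) :
    (j.val : ZMod m) = i.val + 1 ∨ (j.val : ZMod m) = i.val - 1 := by
  rw [cycleGraph_adj_iff hm] at h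
  have hm0 : ((m : ℕ) : ZMod m) = 0 := ZMod.natCast_self m
  rcases h with h | h | ⟨h, h'⟩ | ⟨h, h'⟩
  · left; rw [h]; push_cast; ring
  · right; rw [h]; push_cast; ring
  · right
    rw [h]
    have : ((j.val + 1 : ℕ) : ZMod m) = 0 := by rw [h', hm0]
    push_cast at this ⊢
    linear_combination this
  · left
    rw [h]
    have : ((i.val + 1 : ℕ) : ZMod m) = 0 := by rw [h', hm0]
    push_cast at this ⊢
    linear_combination -this

/-- A set of residues that is constant along `i + 1`, …, `i - 2`. -/
theorem mem_iff_of_forall {m : ℕ} [NeZero m] {D : Finset (ZMod m)} {i : ZMod m}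
    (h : ∀ k, k ≠ i → k ≠ i + 1 → k ≠ i - 1 → (k ∈ D ↔ k - 1 ∈ D)) :
    ∀ k, k ≠ i → k ≠ i - 1 → (k ∈ D ↔ i + 1 ∈ D) := by
  have key : ∀ t : ℕ, t + 2 < m → (i + 1 + (t : ZMod m) ∈ D ↔ i + 1 ∈ D) := by
    intro t ht
    induction t with
    | zero => simp
    | succ t ih =>
      rw [← ih (by omega)]
      have hne : ∀ a : ℕ, 0 < a → a < m → (a : ZMod m) ≠ 0 := by
        intro a ha ham h0
        rw [ZMod.natCast_eq_zero_iff] at h0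
        exact absurd (Nat.le_of_dvd ha h0) (by omega)
      rw [h]
      · push_cast
        rw [show i + 1 + ((t : ZMod m) + 1) - 1 = i + 1 + t by ring]
      · intro h0
        apply hne (t + 2) (by omega) (by omega)
        push_cast at h0 ⊢
        linear_combination h0
      · intro h0
        apply hne (t + 1) (by omega) (by omega)
        push_cast at h0 ⊢
        linear_combination h0
      · intro h0
        apply hne (t + 3) (by omega) (by omega)
        push_cast at h0 ⊢
        linear_combination h0
  intro k hk hk'
  have hval : ((k - (i + 1)).val : ZMod m) = k - (i + 1) := ZMod.natCast_zmod_val _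
  have hlt := ZMod.val_lt (k - (i + 1))
  rw [← key (k - (i + 1)).val, hval, add_sub_cancel]
  by_contra hge
  have hm0 : ((m : ℕ) : ZMod m) = 0 := ZMod.natCast_self m
  have : (k - (i + 1)).val + 1 = m ∨ (k - (i + 1)).val + 2 = m := by omega
  rcases this with h0 | h0
  · apply hk
    have h1 : (((k - (i + 1)).val + 1 : ℕ) : ZMod m) = 0 := by rw [h0, hm0]
    push_cast at h1
    rw [hval] at h1
    linear_combination h1
  · apply hk'
    have h1 : (((k - (i + 1)).val + 2 : ℕ) : ZMod m) = 0 := by rw [h0, hm0]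
    push_cast at h1
    rw [hval] at h1
    linear_combination h1

/-- The sets of at most `n - 1` residues whose size has the parity of `n - 1`. -/
def smallSets (n : ℕ) : Finset (Finset (ZMod (2 * n + 1))) :=
  Finset.univ.filter fun A => A.card ≤ n - 1 ∧ A.card % 2 = (n - 1) % 2

theorem card_smallSets (n : ℕ) : (smallSets n).card =
    ∑ k ∈ Finset.range (2 * n + 2), (2 * n + 1).choose k *
      if k ≤ n - 1 ∧ k % 2 = (n - 1) % 2 then 1 else 0 := by
  rw [smallSets, Finset.card_filter, ← Finset.powerset_univ,
    Finset.sum_powerset_apply_card (fun k => if k ≤ n - 1 ∧ k % 2 = (n - 1) % 2 then 1 else 0),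
    Finset.card_univ, ZMod.card]
  rfl

theorem card_symmDiff_smallSets {n : ℕ} {A B : Finset (ZMod (2 * n + 1))} (hA : A ∈ smallSets n)
    (hB : B ∈ smallSets n) : (A ∆ B).card % 2 = 0 ∧ (A ∆ B).card ≤ 2 * (n - 1) := by
  have h := card_symmDiff_add_two_mul A B
  simp only [smallSets, Finset.mem_filter, Finset.mem_univ, true_and] at hA hB
  omega

/-- If two such words were confused at `i`, then `D = A ∆ B` would contain exactly one of `i - 1`,
`i` and all or none of the other residues. So `D` would have size `1` or `2 * n`, but its size is
even and at most `2 * n - 2`. -/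
theorem isIndepSet_edgeSum (n : ℕ) (hn : 2 ≤ n) :
    (confusionAntihole (2 * n + 1)).IsIndepSet
      ((smallSets n).image edgeSum : Finset (Fin (2 * n + 1) → Bool)) := by
  intro x hx y hy _ hadj
  obtain ⟨A, hA, rfl⟩ := Finset.mem_image.1 (Finset.mem_coe.1 hx)
  obtain ⟨B, hB, rfl⟩ := Finset.mem_image.1 (Finset.mem_coe.1 hy)
  obtain ⟨hpar, hle⟩ := card_symmDiff_smallSets hA hB
  obtain ⟨i, hi, h⟩ := (confusionGraph_ofGraph_compl_adj _ _ _).1 hadj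
  rw [Ne, edgeSum_eq_iff] at hi
  have hD : ∀ k : ZMod (2 * n + 1), k ≠ i.val → k ≠ i.val + 1 → k ≠ i.val - 1 →
      (k ∈ A ∆ B ↔ k - 1 ∈ A ∆ B) := by
    intro k h1 h2 h3
    have hk := (edgeSum_eq_iff A B ⟨k.val, ZMod.val_lt k⟩).1 (h _ ?_ ?_)
    · simpa using hk
    · rintro rfl
      simp at h1
    · intro hadj
      have := cycleGraph_adj_natCast (by omega) hadj
      simp only [ZMod.natCast_zmod_val] at this
      tauto
  have hconst := mem_iff_of_forall hD
  generalize A ∆ B = D at *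
  generalize ((i.val : ℕ) : ZMod (2 * n + 1)) = a at *
  have hcompl : Dᶜ.card + D.card = 2 * n + 1 := by
    rw [Finset.card_compl_add_card, ZMod.card]
  obtain ⟨b, c, hb, hc, hbc⟩ : ∃ b c, b ∈ D ∧ c ∉ D ∧ ∀ k, k ≠ b → k ≠ c →
      (k ∈ D ↔ a + 1 ∈ D) := by
    by_cases ha : a ∈ D
    · exact ⟨a, a - 1, ha, by tauto, hconst⟩
    · exact ⟨a - 1, a, by tauto, ha, fun k h1 h2 => hconst k h2 h1⟩
  by_cases ha : a + 1 ∈ D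
  · have : Dᶜ ⊆ {c} := fun k hk => by
      rw [Finset.mem_compl] at hk
      rw [Finset.mem_singleton]
      by_contra hkc
      exact hk ((hbc k (by rintro rfl; exact hk hb) hkc).2 ha)
    have := Finset.card_le_card this
    rw [Finset.card_singleton] at this
    omega
  · have : D ⊆ {b} := fun k hk => by
      rw [Finset.mem_singleton]
      by_contra hkb
      exact ha ((hbc k hkb (by rintro rfl; exact hc hk)).1 hk)
    have := Finset.card_le_card this
    rw [Finset.card_singleton] at this
    have := Finset.card_pos.2 ⟨b, hb⟩
    omega

/-- Equal edge sums mean that `A ∆ B` is empty or everything, and the latter has odd size. -/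
theorem edgeSum_injOn (n : ℕ) : Set.InjOn edgeSum (smallSets n : Set (Finset (ZMod (2 * n + 1)))) := by
  intro A hA B hB hAB
  obtain ⟨hpar, hle⟩ := card_symmDiff_smallSets (Finset.mem_coe.1 hA) (Finset.mem_coe.1 hB)
  have hD : ∀ k : ZMod (2 * n + 1), k ∈ A ∆ B ↔ k - 1 ∈ A ∆ B := by
    intro k
    have hk := (edgeSum_eq_iff A B ⟨k.val, ZMod.val_lt k⟩).1 (congrFun hAB _)
    simpa using hk
  have hall : ∀ k : ZMod (2 * n + 1), k ∈ A ∆ B ↔ 0 ∈ A ∆ B := by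
    have : ∀ t : ℕ, (t : ZMod (2 * n + 1)) ∈ A ∆ B ↔ 0 ∈ A ∆ B := by
      intro t
      induction t with
      | zero => simp
      | succ t ih =>
        rw [hD, ← ih]
        push_cast
        rw [add_sub_cancel_right]
    intro k
    rw [← this k.val, ZMod.natCast_zmod_val]
  by_cases h0 : 0 ∈ A ∆ B
  · have : A ∆ B = Finset.univ := Finset.eq_univ_iff_forall.2 fun k => (hall k).2 h0
    rw [this, Finset.card_univ, ZMod.card] at hpar
    omega
  · have : A ∆ B = ∅ := Finset.eq_empty_iff_forall_notMem.2 fun k hk => h0 ((hall k).1 hk)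
    rwa [← Finset.bot_eq_empty, symmDiff_eq_bot] at this

theorem fractionalChromaticNumber_confusionAntihole_le {n m : ℕ} (hn : 2 ≤ n)
    (hm : 2 * n + 1 ≤ m) (h : Even (m - (2 * n + 1))) :
    (confusionAntihole m).fractionalChromaticNumber ≤
      2 ^ (2 * n + 1) / ((smallSets n).card : ℝ) := by
  have hne : (smallSets n).Nonempty := by
    obtain ⟨A, -, hA⟩ := Finset.exists_subset_card_eq (s := (Finset.univ : Finset (ZMod (2 * n + 1))))
      (n := n - 1) (by rw [Finset.card_univ, ZMod.card]; omega)
    exact ⟨A, by simp [smallSets, hA]⟩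
  have := fractionalChromaticNumber_le_of_hom (confusionHom (cycleFold (by omega) hm h))
    ((smallSets n).image edgeSum) (hne.image _) (isIndepSet_edgeSum n hn)
  rwa [Finset.card_image_of_injOn (edgeSum_injOn n), Fintype.card_fin] at this

end IndependentSets

/-! ### Comparison of the two bounds. -/

theorem lt_toNat_chromaticNumber {V : Type*} [Finite V] {G : SimpleGraph V} {k : ℕ}
    (h : ¬ G.Colorable k) : k < G.chromaticNumber.toNat := by
  have hc := SimpleGraph.colorable_chromaticNumber_of_fintype G
  by_contra! hle
  exact h (hc.mono hle)

theorem claimA :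
    ∃ c : ℝ, 1 < c ∧ ∀ n : ℕ, 2 ≤ n →
      c * (confusionAntihole (2 * n + 1)).fractionalChromaticNumber <
        ((confusionAntihole (2 * n + 1)).chromaticNumber.toNat : ℝ) := by
  -- The tight case is `n ≥ 8`: `2 ^ 17 / 26333 ≈ 4.9775`, and `1.004` times this is still below
  -- `5`.
  refine ⟨1.004, by norm_num, fun n hn => ?_⟩
  have key : ∀ (k : ℕ) (b : ℝ), (confusionAntihole (2 * n + 1)).fractionalChromaticNumber ≤ b →
      ¬ (confusionAntihole (2 * n + 1)).Colorable k → 1.004 * b < k + 1 →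
      1.004 * (confusionAntihole (2 * n + 1)).fractionalChromaticNumber <
        ((confusionAntihole (2 * n + 1)).chromaticNumber.toNat : ℝ) := by
    intro k b hb hk hbk
    have h1 : ((k + 1 : ℕ) : ℝ) ≤ ((confusionAntihole (2 * n + 1)).chromaticNumber.toNat : ℝ) := by
      exact_mod_cast lt_toNat_chromaticNumber hk
    push_cast at h1
    linarith
  have heven : ∀ j ≤ n, Even (2 * n + 1 - (2 * j + 1)) := fun j hj => ⟨n - j, by omega⟩
  -- At `n = 7` the fractional bound `2 ^ 15 / 6476` still exceeds `5`, so up to there six colours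
  -- must be shown necessary.
  rcases Nat.lt_or_ge n 8 with h8 | h8
  · rcases Nat.lt_or_ge n 3 with h3 | h3
    · obtain rfl : n = 2 := by omega
      have hs : (smallSets 2).card = 5 := by rw [card_smallSets]; decide
      have hf := fractionalChromaticNumber_confusionAntihole_le (n := 2) le_rfl le_rfl (heven 2 hn)
      rw [hs] at hf
      exact key 6 _ hf not_colorable_six_five (by norm_num)
    · have hs : (smallSets 3).card = 22 := by rw [card_smallSets]; decide
      have hf := fractionalChromaticNumber_confusionAntihole_le (n := 3) (m := 2 * n + 1)
        (by norm_num) (by omega) (heven 3 h3)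
      rw [hs] at hf
      refine key 5 _ hf (fun hc => not_colorable_fifteen_five ?_) (by norm_num)
      exact confusionAntihole_colorable_of_le (by omega) (by omega) ⟨7 - n, by omega⟩ hc
  · have hs : (smallSets 8).card = 26333 := by
      rw [card_smallSets]
      decide +kernel
    have hf := fractionalChromaticNumber_confusionAntihole_le (n := 8) (m := 2 * n + 1)
      (by norm_num) (by omega) (heven 8 h8)
    rw [hs] at hf
    exact key 4 _ hf (not_colorable_four (by omega)) (by norm_num)
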